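/- Let $A$ be a finite dimensional commutative $\mathbb{Q}$-algebra with unit element. Let $F\subset A$ be its separable part, that is, the subalgebra of all $a\in A$ for which the multiplication $A\to A$, $b\mapsto ab$, is a semisimple $\mathbb{Q}$-linear map, and let $R\subset A$ be the radical, that is, the ideal of all nilpotent elements. Then $A=F\oplus R$ as a vector space, and the projection $\mathrm{pr}_F:A\to F$ along $R$ is a homomorphism of algebras. For $B\in\{A,F\}$ let $\mathcal{L}(B)$ be the set of full lattices in $B$, that is, of finitely generated $\mathbb{Z}$-submodules of $B$ which generate $B$ over $\mathbb{Q}$. It is a commutative semigroup with the product $L_1\cdot L_2$, the set of all finite sums of products $ab$ with $a\in L_1$, $b\in L_2$. Full lattices $L_1,L_2$ in $B$ are called $\varepsilon$-equivalent if $aL_1=L_2$ for some unit $a$ of $B$. The class of $L$ is denoted $[L]_\varepsilon$, and the set $\mathcal{E}(B)$ of $\varepsilon$-classes is a commutative semigroup with $[L_1]_\varepsilon[L_2]_\varepsilon=[L_1L_2]_\varepsilon$. An order in $B$ is a full lattice $\Lambda$ with $1\in\Lambda$ and $\Lambda\cdot\Lambda\subset\Lambda$; then $\Lambda$ and $[\Lambda]_\varepsilon$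 are idempotent. For an idempotent $c$ of a commutative semigroup $S$ let $G(c)$ be the group, with unit element $c$, of all $a\in S$ with $ac=a$ such that some $b\in S$ satisfies $ab=c$. Theorem. The projection $\mathrm{pr}_F$ induces surjective homomorphisms of semigroups $\mathcal{L}(A)\to\mathcal{L}(F)$, $L\mapsto\mathrm{pr}_FL$, and $\mathcal{E}(A)\to\mathcal{E}(F)$, $[L]_\varepsilon\mapsto[\mathrm{pr}_FL]_\varepsilon$. For each order $\Lambda$ in $A$, $\mathrm{pr}_F\Lambda$ is an order in $F$, and these homomorphisms restrict to a surjective group homomorphism $$G(\Lambda)\to G(\mathrm{pr}_F\Lambda),\quad L\mapsto\mathrm{pr}_FL,$$ and to an isomorphism $$G([\Lambda]_\varepsilon)\to G([\mathrm{pr}_F\Lambda]_\varepsilon),\quad [L]_\varepsilon\mapsto[\mathrm{pr}_FL]_\varepsilon,$$ of finite groups. -/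

import Mathlib

/-! ### Commutative semigroups -/

section Semigroups

/-- `IsInvertibleAt c a`: the element `a` of the commutative semigroup `S` is invertible with
`e_a = c`, that is, `a * c = a` and `a * b = c` for some `b` (such a `c` is unique, see
`IsInvertibleAt.unique`). -/
def IsInvertibleAt {S : Type*} [CommSemigroup S] (c a : S) : Prop :=
  a * c = a ∧ ∃ b, a * b = c

theorem IsInvertibleAt.unique {S : Type*} [CommSemigroup S] {a c d : S}
    (hc : IsInvertibleAt c a) (hd : IsInvertibleAt d a) : c = d := by
  obtain ⟨hc1, b, hb⟩ := hc
  obtain ⟨hd1, b', hb'⟩ := hd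
  have h1 : c * d = c := by rw [← hb, mul_right_comm, hd1]
  have h2 : d * c = d := by rw [← hb', mul_right_comm, hc1]
  rw [← h1, mul_comm, h2]

/-- For an idempotent `c` of a commutative semigroup `S`, the group `G(c)` of all invertible
elements `a` of `S` with `e_a = c`. -/
def IdemGroup {S : Type*} [CommSemigroup S] (c : S) (_hc : IsIdempotentElem c) : Type _ :=
  {a : S // IsInvertibleAt c a}

namespace IdemGroup

variable {S T : Type*} [CommSemigroup S] [CommSemigroup T]

/-- The group structure on `G(c)`: multiplication is that of `S`, the unit element is `c`. -/
noncomputable instance instCommGroup (c : S) (hc : IsIdempotentElem c) :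
    CommGroup (IdemGroup c hc) where
  mul a a' := ⟨a.1 * a'.1, by
    obtain ⟨a, ha, b, hb⟩ := a
    obtain ⟨a', ha', b', hb'⟩ := a'
    change IsInvertibleAt c (a * a')
    refine ⟨by rw [mul_assoc, ha'], b * b', ?_⟩
    rw [mul_mul_mul_comm, hb, hb', hc.eq]⟩
  one := ⟨c, hc, c, hc⟩
  inv a := ⟨a.2.2.choose * c, by
    have h := a.2.2.choose_spec
    refine ⟨by rw [mul_assoc, hc.eq], a.1, ?_⟩
    rw [mul_right_comm, mul_comm _ a.1, h, hc.eq]⟩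
  mul_assoc a b d := Subtype.ext (mul_assoc a.1 b.1 d.1)
  one_mul a := Subtype.ext ((mul_comm c a.1).trans a.2.1)
  mul_one a := Subtype.ext a.2.1
  mul_comm a b := Subtype.ext (mul_comm a.1 b.1)
  inv_mul_cancel a := Subtype.ext (by
    change a.2.2.choose * c * a.1 = c
    rw [mul_right_comm, mul_comm _ a.1, a.2.2.choose_spec, hc.eq])

/-- A homomorphism `f` of commutative semigroups with `f c = d` restricts to a group homomorphism
`G(c) → G(d)`, `a ↦ f a`. -/
noncomputable def map (f : S →ₙ* T) {c : S} {d : T} (hc : IsIdempotentElem c)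
    (hd : IsIdempotentElem d) (h : f c = d) : IdemGroup c hc →* IdemGroup d hd where
  toFun a := ⟨f a.1, by
    obtain ⟨a, ha, b, hb⟩ := a
    change IsInvertibleAt d (f a)
    exact ⟨by rw [← h, ← map_mul, ha], f b, by rw [← h, ← map_mul, hb]⟩⟩
  map_one' := Subtype.ext h
  map_mul' a b := Subtype.ext (map_mul f a.1 b.1)

end IdemGroup

end Semigroups

/-! ### Full lattices and orders -/

section Lattices

set_option linter.unusedSectionVars false

/-- A full lattice in `A`: a finitely generated `ℤ`-submodule which generates `A` over `ℚ`. -/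
@[ext]
structure FullLattice (A : Type*) [CommRing A] [Algebra ℚ A] where
  toSubmodule : Submodule ℤ A
  fg : toSubmodule.FG
  span_eq_top : Submodule.span ℚ (toSubmodule : Set A) = ⊤

namespace FullLattice

variable {A B : Type*} [CommRing A] [Algebra ℚ A] [CommRing B] [Algebra ℚ B]

open scoped Pointwise in
/-- The product `L₁ · L₂` is the set of finite sums of products `a * b`, `a ∈ L₁`, `b ∈ L₂`. -/
instance : Mul (FullLattice A) where
  mul L₁ L₂ :=
    { toSubmodule := L₁.toSubmodule * L₂.toSubmodule
      fg := L₁.fg.mul L₂.fg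
      span_eq_top := by
        rw [eq_top_iff]
        have h : (⊤ : Submodule ℚ A) = Submodule.span ℚ
            ((L₁.toSubmodule : Set A) * (L₂.toSubmodule : Set A)) := by
          rw [← Submodule.span_mul_span, L₁.span_eq_top, L₂.span_eq_top]
          refine le_antisymm (fun x _ => ?_) le_top
          simpa using Submodule.mul_mem_mul (Submodule.mem_top (x := x) (R := ℚ))
            (Submodule.mem_top (x := (1 : A)) (R := ℚ))
        rw [h]
        refine Submodule.span_mono ?_
        rintro _ ⟨a, ha, b, hb, rfl⟩
        exact Submodule.mul_mem_mul ha hb }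

theorem toSubmodule_mul (L₁ L₂ : FullLattice A) :
    (L₁ * L₂).toSubmodule = L₁.toSubmodule * L₂.toSubmodule := rfl

/-- The commutative semigroup `𝓛(A)` of full lattices in `A`. -/
instance : CommSemigroup (FullLattice A) where
  mul_assoc _ _ _ := FullLattice.ext (mul_assoc _ _ _)
  mul_comm _ _ := FullLattice.ext (mul_comm _ _)

/-- An order in `A` is a full lattice `Λ` with `1 ∈ Λ` and `Λ · Λ ⊆ Λ`. -/
structure IsOrder (Λ : FullLattice A) : Prop where
  one_mem : (1 : A) ∈ Λ.toSubmodule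
  mul_le : (Λ * Λ).toSubmodule ≤ Λ.toSubmodule

theorem IsOrder.isIdempotentElem {Λ : FullLattice A} (h : Λ.IsOrder) : IsIdempotentElem Λ :=
  FullLattice.ext (le_antisymm h.mul_le fun x hx => by
    have h' := Submodule.mul_mem_mul hx h.one_mem
    rwa [mul_one] at h')

/-- The homomorphism `𝓛(A) → 𝓛(B)`, `L ↦ f(L)`, for a surjective algebra homomorphism
`f : A → B`. -/
def map (f : A →ₐ[ℚ] B) (hf : Function.Surjective f) : FullLattice A →ₙ* FullLattice B where
  toFun L :=
    { toSubmodule := L.toSubmodule.map f.toRingHom.toIntAlgHom.toLinearMap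
      fg := L.fg.map _
      span_eq_top := by
        have h := congrArg (Submodule.map f.toLinearMap) L.span_eq_top
        rw [Submodule.map_span, Submodule.map_top, LinearMap.range_eq_top.2 hf] at h
        exact h }
  map_mul' L₁ L₂ := FullLattice.ext (Submodule.map_mul _ _ _)

theorem mem_map (f : A →ₐ[ℚ] B) (hf : Function.Surjective f) (L : FullLattice A) (y : B) :
    y ∈ (map f hf L).toSubmodule ↔ ∃ x ∈ L.toSubmodule, f x = y := Iff.rfl

theorem IsOrder.map {Λ : FullLattice A} (h : Λ.IsOrder) (f : A →ₐ[ℚ] B)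
    (hf : Function.Surjective f) : (map f hf Λ).IsOrder where
  one_mem := (mem_map f hf Λ 1).2 ⟨1, h.one_mem, map_one f⟩
  mul_le := by rw [← map_mul, h.isIdempotentElem.eq]

/-- `a L` for a unit `a` of `A` -/
def unitMul (a : Aˣ) (L : Submodule ℤ A) : Submodule ℤ A :=
  L.map (LinearMap.mulLeft ℤ (a : A))

theorem mem_unitMul (a : Aˣ) (L : Submodule ℤ A) (x : A) :
    x ∈ unitMul a L ↔ ∃ y ∈ L, (a : A) * y = x := Iff.rfl

theorem unitMul_mul (a b : Aˣ) (L M : Submodule ℤ A) :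
    unitMul (a * b) (L * M) = unitMul a L * unitMul b M := by
  have key : ∀ (c : Aˣ) (N : Submodule ℤ A), unitMul c N = Submodule.span ℤ {(c : A)} * N := by
    intro c N
    ext x
    rw [mem_unitMul, Submodule.mem_span_singleton_mul]
  rw [key, key, key, Units.val_mul, mul_mul_mul_comm, Submodule.span_mul_span,
    Set.singleton_mul_singleton]

/-- The `ε`-equivalence on `𝓛(A)`: `L₁ ∼ L₂` iff `a L₁ = L₂` for some unit `a` of `A`. It is an
equivalence relation compatible with the multiplication. -/
def epsCon (A : Type*) [CommRing A] [Algebra ℚ A] : Con (FullLattice A) where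
  r L₁ L₂ := ∃ a : Aˣ, unitMul a L₁.toSubmodule = L₂.toSubmodule
  iseqv :=
    { refl := fun L => ⟨1, by ext x; simp [mem_unitMul]⟩
      symm := by
        rintro L₁ L₂ ⟨a, h⟩
        refine ⟨a⁻¹, ?_⟩
        rw [← h]
        ext x
        simp [mem_unitMul]
      trans := by
        rintro L₁ L₂ L₃ ⟨a, h⟩ ⟨b, h'⟩
        refine ⟨b * a, ?_⟩
        rw [← h', ← h]
        ext x
        simp [mem_unitMul, mul_assoc] }
  mul' := by
    rintro L₁ L₂ L₃ L₄ ⟨a, h⟩ ⟨b, h'⟩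
    exact ⟨a * b, by rw [toSubmodule_mul, toSubmodule_mul, unitMul_mul, h, h']⟩

end FullLattice

/-- The commutative semigroup `𝓔(A)` of `ε`-classes of full lattices in `A`. -/
abbrev EpsClass (A : Type*) [CommRing A] [Algebra ℚ A] : Type _ :=
  (FullLattice.epsCon A).Quotient

namespace EpsClass

variable {A B : Type*} [CommRing A] [Algebra ℚ A] [CommRing B] [Algebra ℚ B]

/-- The `ε`-class `[L]_ε` of a full lattice `L`. -/
def mk (L : FullLattice A) : EpsClass A := (L : (FullLattice.epsCon A).Quotient)

theorem mk_mul (L M : FullLattice A) : mk (L * M) = mk L * mk M := rfl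

theorem isIdempotentElem_mk {Λ : FullLattice A} (h : Λ.IsOrder) : IsIdempotentElem (mk Λ) := by
  rw [IsIdempotentElem, ← mk_mul, h.isIdempotentElem.eq]

/-- The homomorphism `𝓔(A) → 𝓔(B)`, `[L]_ε ↦ [f(L)]_ε`, for a surjective algebra homomorphism
`f : A → B`. -/
def map (f : A →ₐ[ℚ] B) (hf : Function.Surjective f) : EpsClass A →ₙ* EpsClass B where
  toFun x := Con.liftOn x (fun L => mk (FullLattice.map f hf L)) (by
    rintro L M ⟨a, h⟩
    refine (Con.eq _).2 ⟨Units.map (f : A →* B) a, ?_⟩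
    ext x
    constructor
    · rintro ⟨_, ⟨y, hy, rfl⟩, rfl⟩
      refine ⟨a * y, ?_, map_mul f _ _⟩
      rw [← h]
      exact ⟨y, hy, rfl⟩
    · rintro ⟨y, hy, rfl⟩
      rw [← h] at hy
      obtain ⟨z, hz, rfl⟩ := hy
      exact ⟨f z, ⟨z, hz, rfl⟩, (map_mul f _ _).symm⟩)
  map_mul' x y := by
    induction x using Con.induction_on
    induction y using Con.induction_on
    exact congrArg mk (map_mul (FullLattice.map f hf) _ _)

theorem map_mk (f : A →ₐ[ℚ] B) (hf : Function.Surjective f) (L : FullLattice A) :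
    map f hf (mk L) = mk (FullLattice.map f hf L) := rfl

end EpsClass

end Lattices

/-! ### The decomposition of `A` into its separable part and its radical -/

section SeparablePart

variable (A : Type*) [CommRing A] [Algebra ℚ A] [FiniteDimensional ℚ A]

/-- The separable part `F` of `A`: the subalgebra of all `a` such that the multiplication by `a`
is a semisimple endomorphism of the `ℚ`-vector space `A`. -/
def sepPart : Subalgebra ℚ A where
  carrier := {a | (Algebra.lmul ℚ A a).IsSemisimple}
  mul_mem' {a b} ha hb := by
    simp only [Set.mem_ofPred_eq, map_mul] at *
    exact ha.mul_of_commute ((Commute.all a b).map (Algebra.lmul ℚ A)) hb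
  add_mem' {a b} ha hb := by
    simp only [Set.mem_ofPred_eq, map_add] at *
    exact ha.add_of_commute ((Commute.all a b).map (Algebra.lmul ℚ A)) hb
  algebraMap_mem' q := by
    have h := (Module.End.isSemisimple_id (R := ℚ) (M := A)).aeval (Polynomial.C q)
    simp only [Set.mem_ofPred_eq, AlgHom.commutes]
    simpa using h

/-- The radical `R` of `A`, the set of all nilpotent elements, as a `ℚ`-subspace. -/
def radPart : Submodule ℚ A := (nilradical A).restrictScalars ℚ

/-- The decomposition `A = F ⊕ R`. -/
theorem isCompl_sepPart_radPart : IsCompl (Subalgebra.toSubmodule (sepPart A)) (radPart A) := by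
  have hinj : Function.Injective (Algebra.lmul ℚ A) := Algebra.lmul_injective
  constructor
  · rw [Submodule.disjoint_def]
    intro x hx hx'
    have h1 : (Algebra.lmul ℚ A x).IsSemisimple := hx
    have h2 : IsNilpotent x := hx'
    have h3 := Module.End.eq_zero_of_isNilpotent_isSemisimple (h2.map (Algebra.lmul ℚ A)) h1
    exact hinj (by rw [h3, map_zero])
  · rw [codisjoint_iff, eq_top_iff]
    intro a _
    obtain ⟨n, hn, s, hs, hnil, hss, h⟩ :=
      (Algebra.lmul ℚ A a).exists_isNilpotent_isSemisimple
    rw [← AlgHom.map_adjoin_singleton] at hn hs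
    obtain ⟨n, -, rfl⟩ := hn
    obtain ⟨s, -, rfl⟩ := hs
    have h' : a = s + n := hinj (by rw [map_add, h, add_comm]; rfl)
    have hn' : IsNilpotent n := (IsNilpotent.map_iff hinj).1 hnil
    rw [h']
    exact Submodule.add_mem_sup hss hn'

/-- The projection `pr_F : A → F` with respect to the decomposition `A = F ⊕ R`; it is a
homomorphism of algebras. -/
noncomputable def prF : A →ₐ[ℚ] sepPart A :=
  AlgHom.ofLinearMap
    (Submodule.projectionOnto (Subalgebra.toSubmodule (sepPart A)) (radPart A)
      (isCompl_sepPart_radPart A))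
    (Submodule.projectionOnto_apply_left (isCompl_sepPart_radPart A) (1 : sepPart A))
    (by
      set p := Submodule.projectionOnto (Subalgebra.toSubmodule (sepPart A)) (radPart A)
        (isCompl_sepPart_radPart A) with hp
      have hr : ∀ x ∈ radPart A, p x = 0 := fun x hx =>
        Submodule.projectionOnto_apply_right (isCompl_sepPart_radPart A) ⟨x, hx⟩
      have hl : ∀ x : sepPart A, p x = x := fun x =>
        Submodule.projectionOnto_apply_left (isCompl_sepPart_radPart A) x
      have hdec : ∀ x : A, ∃ y : sepPart A, ∃ z ∈ radPart A, x = y + z := by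
        intro x
        obtain ⟨y, hy, z, hz, h⟩ := Submodule.mem_sup.1
          ((isCompl_sepPart_radPart A).sup_eq_top ▸ Submodule.mem_top (x := x))
        exact ⟨⟨y, hy⟩, z, hz, h.symm⟩
      intro x x'
      obtain ⟨y, z, hz, rfl⟩ := hdec x
      obtain ⟨y', z', hz', rfl⟩ := hdec x'
      have h1 : ((y : A) + z) * (y' + z') =
          ((y * y' : sepPart A) : A) + (z * (y' + z') + y * z') := by
        push_cast; ring
      have h2 : z * (y' + z') + y * z' ∈ radPart A :=
        (nilradical A).add_mem ((nilradical A).mul_mem_right _ hz)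
          ((nilradical A).mul_mem_left _ hz')
      rw [h1, map_add p _ (z * (y' + z') + y * z'), map_add p (y : A) z, map_add p (y' : A) z',
        hl, hl, hl, hr _ hz, hr _ hz', hr _ h2]
      simp only [add_zero])

theorem prF_apply_coe (x : sepPart A) : prF A x = x :=
  Submodule.projectionOnto_apply_left (isCompl_sepPart_radPart A) x

theorem prF_surjective : Function.Surjective (prF A) := fun x => ⟨x, prF_apply_coe A x⟩

/-- The homomorphism of semigroups `𝓛(A) → 𝓛(F)`, `L ↦ pr_F L`. -/
noncomputable def prFLattice : FullLattice A →ₙ* FullLattice (sepPart A) :=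
  FullLattice.map (prF A) (prF_surjective A)

/-- The homomorphism of semigroups `𝓔(A) → 𝓔(F)`, `[L]_ε ↦ [pr_F L]_ε`. -/
noncomputable def prFEps : EpsClass A →ₙ* EpsClass (sepPart A) :=
  EpsClass.map (prF A) (prF_surjective A)

variable {A}

theorem FullLattice.IsOrder.prFLattice {Λ : FullLattice A} (h : Λ.IsOrder) :
    (prFLattice A Λ).IsOrder :=
  h.map (prF A) (prF_surjective A)

end SeparablePart

/-! ### The groups attached to an order -/

section Groups

variable {A : Type*} [CommRing A] [Algebra ℚ A]

/-- The group `G(Λ)` of the invertible full lattices `L` in `𝓛(A)` with `e_L = Λ`. -/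
abbrev latticeGroup (Λ : FullLattice A) (h : Λ.IsOrder) : Type _ :=
  IdemGroup Λ h.isIdempotentElem

/-- The group `G([Λ]_ε)` of the invertible elements `x` in `𝓔(A)` with `e_x = [Λ]_ε`. -/
abbrev epsGroup (Λ : FullLattice A) (h : Λ.IsOrder) : Type _ :=
  IdemGroup (EpsClass.mk Λ) (EpsClass.isIdempotentElem_mk h)

variable [FiniteDimensional ℚ A]

/-- The group homomorphism `G(Λ) → G(pr_F Λ)`, `L ↦ pr_F L`. -/
noncomputable def latticeGroupMap (Λ : FullLattice A) (h : Λ.IsOrder) :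
    latticeGroup Λ h →* latticeGroup (prFLattice A Λ) h.prFLattice :=
  IdemGroup.map (prFLattice A) _ _ rfl

/-- The group homomorphism `G([Λ]_ε) → G([pr_F Λ]_ε)`, `[L]_ε ↦ [pr_F L]_ε`. -/
noncomputable def epsGroupMap (Λ : FullLattice A) (h : Λ.IsOrder) :
    epsGroup Λ h →* epsGroup (prFLattice A Λ) h.prFLattice :=
  IdemGroup.map (prFEps A) _ _ rfl

end Groups

/-!
The projection `f = pr_F : A → F` is surjective with nil kernel, and `F` is reduced. Everything but
finiteness holds for all surjections `f : A → B` with nil kernel.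

* Surjectivity `𝓛(A) → 𝓛(B)`: lift generators, and add generators of the vector space `ker f`.
* Surjectivity `G(Λ) → G(f(Λ))` (`FullLattice.exists_isInvertibleAt_map_eq`): if `L' M' = f(Λ)`,
  write `1 = ∑ xᵢ yᵢ` with `xᵢ ∈ L'` and `yⱼ ∈ M'`. The matrix `(xᵢ yⱼ)` over `f(Λ)` is idempotent,
  and idempotents lift to an idempotent matrix `E` over `Λ`. Since two commuting idempotents with
  nilpotent difference are equal, `E` is again of the form `(vᵢ wⱼ)` with `∑ vᵢ wᵢ = 1`
  (`exists_rank_one_lift`), so `∑ Λ vᵢ` is a lift of `L'` with inverse `∑ Λ wⱼ`.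
* Injectivity `G([Λ]) → G([f(Λ)])` (`EpsClass.eq_mk_of_map_eq`): classes in `G([Λ])` have
  representatives in `G(Λ)`. If `f(L) = f(Λ)` and `L M = Λ`, choose `x ∈ L` and `y ∈ M` over `1`;
  then `x y` is `1` plus a nilpotent element of `Λ`, so it is a unit of `Λ`, and `L = x Λ`.

For finiteness, the reduced algebra `F` is a product of number fields. A lattice over the maximal
order is the product of fractional ideals of the factors, so there are finitely many classes
of them, by finiteness of the class groups (`finite_setOf_mul_mk_maxOrder_eq`). For a general
order `Λ` and the maximal order `O`, the map `[L] ↦ [L O]` has finite fibres, because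
`n L O ⊆ L ⊆ L O` for some integer `n ≠ 0` with `n O ⊆ Λ` (`EpsClass.finite_setOf_mul_mk_eq`).
The group `G([Λ])` of `A` is then finite because it is isomorphic to that of `F`.
-/

/-! ### Surjections with nil kernel -/

section NilKernel

open Matrix

variable {A B : Type*} [CommRing A] [CommRing B]

theorem isUnit_of_isUnit_map_of_ker_nil (f : A →+* B) (hf : Function.Surjective f)
    (hnil : ∀ x, f x = 0 → IsNilpotent x) {a : A} (ha : IsUnit (f a)) : IsUnit a := by
  obtain ⟨b, hb⟩ := ha.exists_right_inv
  obtain ⟨b, rfl⟩ := hf b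
  have h : IsNilpotent (a * b - 1) := hnil _ (by rw [map_sub, map_mul, hb, map_one, sub_self])
  have h1 : IsUnit (a * b) := by
    have := h.isUnit_one_add
    rwa [add_sub_cancel] at this
  exact isUnit_of_mul_isUnit_left h1

theorem Matrix.isNilpotent_of_forall_mem {n : Type*} [Fintype n] [DecidableEq n] {I : Ideal A}
    (hI : IsNilpotent I) {M : Matrix n n A} (hM : ∀ i j, M i j ∈ I) : IsNilpotent M := by
  obtain ⟨k, hk⟩ := hI
  have key : ∀ k i j, (M ^ k) i j ∈ I ^ k := by
    intro k
    induction k with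
    | zero => simp
    | succ k ih =>
      intro i j
      rw [pow_succ, pow_succ, Matrix.mul_apply]
      exact Ideal.sum_mem _ fun l _ => Ideal.mul_mem_mul (ih i l) (hM l j)
  refine ⟨k, ?_⟩
  ext i j
  have := key k i j
  rw [hk] at this
  simpa using this

/-- A factorization `e = x yᵀ`, `yᵀ x = 1`, of an idempotent matrix of rank one over `B` lifts to
every idempotent matrix `E` over `A` which lifts `e`. Arbitrary lifts `v`, `w` of `x`, `y` are
corrected to `E v` and `wᵀ E`, up to a unit; the idempotent `E v wᵀ E` so obtained is
contained in `E` and differs from it by a nilpotent matrix. -/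
theorem exists_rank_one_lift [IsNoetherianRing A] (f : A →+* B) (hf : Function.Surjective f)
    (hnil : ∀ x, f x = 0 → IsNilpotent x) {n : Type*} [Fintype n] [DecidableEq n]
    {E : Matrix n n A} (hE : IsIdempotentElem E) (x y : n → B)
    (hxy : y ⬝ᵥ x = 1) (hEf : E.map f = vecMulVec x y) :
    ∃ x' y' : n → A, (∀ i, f (x' i) = x i) ∧ y' ⬝ᵥ x' = 1 ∧ E = vecMulVec x' y' := by
  choose g hg using hf
  set v : n → A := fun i => g (x i) with hv
  set w : n → A := fun i => g (y i) with hw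
  have hfv : f ∘ v = x := funext fun i => hg _
  have hfw : f ∘ w = y := funext fun i => hg _
  have hfEv : f ∘ (E *ᵥ v) = x := by
    funext i
    rw [Function.comp_apply, RingHom.map_mulVec, hEf, hfv, vecMulVec_mulVec, hxy]
    simp
  have hfu : f (w ⬝ᵥ (E *ᵥ v)) = 1 := by
    rw [RingHom.map_dotProduct, hfEv, hfw, hxy]
  obtain ⟨u, hu⟩ := isUnit_of_isUnit_map_of_ker_nil f (fun b => ⟨g b, hg b⟩) hnil
    (a := w ⬝ᵥ (E *ᵥ v)) (by rw [hfu]; exact isUnit_one)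
  have hfu' : f (↑u⁻¹ : A) = 1 := by
    have h1 : f (↑u⁻¹ : A) * f (u : A) = 1 := by rw [← map_mul, Units.inv_mul, map_one]
    rwa [hu, hfu, mul_one] at h1
  set x' := E *ᵥ v with hx'
  set y' := (↑u⁻¹ : A) • (w ᵥ* E) with hy'
  have hEx : E *ᵥ x' = x' := by rw [hx', mulVec_mulVec, hE.eq]
  have hyE : y' ᵥ* E = y' := by rw [hy', smul_vecMul, vecMul_vecMul, hE.eq]
  have hyx : y' ⬝ᵥ x' = 1 := by
    rw [hy', smul_dotProduct, ← dotProduct_mulVec, hEx, ← hu, smul_eq_mul, Units.inv_mul]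
  have hfy : f ∘ y' = y := by
    funext i
    rw [Function.comp_apply, hy', Pi.smul_apply, smul_eq_mul, map_mul, hfu', one_mul,
      RingHom.map_vecMul, hEf, hfw, vecMul_vecMulVec, hxy]
    simp
  refine ⟨x', y', fun i => congrFun hfEv i, hyx, ?_⟩
  set P := vecMulVec x' y' with hP
  have hPP : P * P = P := by rw [hP, vecMulVec_mul_vecMulVec, hyx, one_smul]
  have hEP : E * P = P := by rw [hP, mul_vecMulVec, hEx]
  have hPE : P * E = P := by rw [hP, vecMulVec_mul, hyE]
  have hD : IsIdempotentElem (E - P) := by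
    rw [IsIdempotentElem, mul_sub, sub_mul, sub_mul, hE.eq, hPE, hEP, hPP, sub_self, sub_zero]
  have hDn : IsNilpotent (E - P) := by
    refine Matrix.isNilpotent_of_forall_mem (IsNoetherianRing.isNilpotent_nilradical A)
      fun i j => hnil _ ?_
    have h1 : f (E i j) = x i * y j := congrFun (congrFun hEf i) j
    have h2 : f (P i j) = x i * y j := by
      rw [hP, vecMulVec_apply, map_mul]
      exact congrArg₂ (· * ·) (congrFun hfEv i) (congrFun hfy j)
    rw [Matrix.sub_apply, map_sub, h1, h2, sub_self]
  obtain ⟨k, hk⟩ := hDn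
  have h0 : E - P = 0 := by
    rw [← hD.pow_succ_eq k, pow_succ, hk, zero_mul]
  exact sub_eq_zero.1 h0

/-- Idempotent matrices lift along a surjection with nil kernel between subrings. -/
theorem exists_isIdempotentElem_matrix_lift [IsNoetherianRing A] (f : A →+* B)
    (hnil : ∀ x, f x = 0 → IsNilpotent x) (S : Subring A)
    {n : Type*} [Fintype n] [DecidableEq n] {e : Matrix n n B} (he : IsIdempotentElem e)
    (heS : ∀ i j, ∃ s ∈ S, f s = e i j) :
    ∃ E : Matrix n n A, IsIdempotentElem E ∧ (∀ i j, E i j ∈ S) ∧ E.map f = e := by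
  choose s hs hse using heS
  obtain ⟨E, hE, hEe⟩ := exists_isIdempotentElem_eq_of_ker_isNilpotent
    ((f.comp S.subtype).mapMatrix : Matrix n n S →+* Matrix n n B) (fun M hM => by
      have h : IsNilpotent ((S.subtype.mapMatrix : Matrix n n S →+* Matrix n n A) M) := by
        refine Matrix.isNilpotent_of_forall_mem (IsNoetherianRing.isNilpotent_nilradical A)
          fun i j => hnil _ ?_
        exact congrFun (congrFun hM i) j
      refine (IsNilpotent.map_iff (f := (S.subtype.mapMatrix : Matrix n n S →+* Matrix n n A)) ?_).1 h
      intro M N hMN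
      ext i j
      exact congrFun (congrFun hMN i) j) e
    ⟨Matrix.of fun i j => ⟨s i j, hs i j⟩, by ext i j; exact hse i j⟩ he
  refine ⟨S.subtype.mapMatrix E, hE.map _, fun i j => (E i j).2, ?_⟩
  rw [← hEe]
  rfl

end NilKernel

/-! ### Lattices under surjections with nil kernel -/

namespace FullLattice

variable {A B : Type*} [CommRing A] [Algebra ℚ A] [CommRing B] [Algebra ℚ B]

theorem mul_mem_mul {L M : FullLattice A} {x y : A} (hx : x ∈ L.toSubmodule)
    (hy : y ∈ M.toSubmodule) : x * y ∈ (L * M).toSubmodule :=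
  Submodule.mul_mem_mul hx hy

/-- The subring of `A` underlying an order. -/
def IsOrder.toSubring {Λ : FullLattice A} (h : Λ.IsOrder) : Subring A where
  carrier := Λ.toSubmodule
  mul_mem' hx hy := h.mul_le (mul_mem_mul hx hy)
  one_mem' := h.one_mem
  add_mem' := Λ.toSubmodule.add_mem
  zero_mem' := Λ.toSubmodule.zero_mem
  neg_mem' := Λ.toSubmodule.neg_mem

theorem _root_.Submodule.exists_sum_of_mem_mul {A : Type*} [CommRing A] {L M : Submodule ℤ A}
    {z : A} (hz : z ∈ L * M) :
    ∃ (n : ℕ) (x y : Fin n → A), (∀ i, x i ∈ L) ∧ (∀ i, y i ∈ M) ∧ ∑ i, x i * y i = z := by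
  induction hz using Submodule.mul_induction_on' with
  | mem_mul_mem a ha b hb => exact ⟨1, fun _ => a, fun _ => b, by simp [ha], by simp [hb], by simp⟩
  | add a _ b _ iha ihb =>
    obtain ⟨n, x, y, hx, hy, rfl⟩ := iha
    obtain ⟨m, x', y', hx', hy', rfl⟩ := ihb
    refine ⟨n + m, Fin.append x x', Fin.append y y', fun i => ?_, fun i => ?_, ?_⟩
    · refine Fin.addCases (fun i => ?_) (fun i => ?_) i <;> simp [hx, hx']
    · refine Fin.addCases (fun i => ?_) (fun i => ?_) i <;> simp [hy, hy']
    · simp [Fin.sum_univ_add]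

/-- A preimage of a lattice is generated by lifts of its generators and generators of the
`ℚ`-vector space `ker f`. -/
theorem map_surjective [FiniteDimensional ℚ A] (f : A →ₐ[ℚ] B) (hf : Function.Surjective f) :
    Function.Surjective (map f hf) := by
  intro M
  obtain ⟨s, hs⟩ := M.fg
  obtain ⟨t, ht⟩ := (inferInstance : IsNoetherian ℚ A).noetherian (LinearMap.ker f.toLinearMap)
  classical
  obtain ⟨g, hg⟩ := hf.hasRightInverse
  have hmap : (Submodule.span ℤ ((s.image g ∪ t : Finset A) : Set A)).map
      f.toRingHom.toIntAlgHom.toLinearMap = M.toSubmodule := by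
    rw [← hs, Submodule.map_span]
    refine le_antisymm (Submodule.span_le.2 ?_) (Submodule.span_le.2 ?_)
    · rintro _ ⟨x, hx, rfl⟩
      rcases Finset.mem_union.1 (Finset.mem_coe.1 hx) with hx | hx
      · obtain ⟨y, hy, rfl⟩ := Finset.mem_image.1 hx
        exact Submodule.subset_span (by simpa [hg y] using hy)
      · have : x ∈ LinearMap.ker f.toLinearMap := ht ▸ Submodule.subset_span hx
        have h0 : f x = 0 := this
        simp [h0]
    · intro y hy
      exact Submodule.subset_span ⟨g y, by simpa using Or.inl ⟨y, hy, rfl⟩, hg y⟩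
  refine ⟨⟨Submodule.span ℤ ((s.image g ∪ t : Finset A) : Set A), ⟨_, rfl⟩, ?_⟩,
    FullLattice.ext hmap⟩
  rw [Submodule.span_span_of_tower, eq_top_iff]
  have hker : LinearMap.ker f.toLinearMap ≤
      Submodule.span ℚ ((s.image g ∪ t : Finset A) : Set A) := by
    rw [← ht]
    exact Submodule.span_mono (by simp)
  intro a _
  have hfa : f a ∈ (Submodule.span ℚ ((s.image g ∪ t : Finset A) : Set A)).map f.toLinearMap := by
    have h1 : Submodule.span ℚ (M.toSubmodule : Set B) ≤
        (Submodule.span ℚ ((s.image g ∪ t : Finset A) : Set A)).map f.toLinearMap := by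
      rw [← hs, Submodule.span_span_of_tower, Submodule.span_le]
      intro y hy
      exact ⟨g y, Submodule.subset_span (by simpa using Or.inl ⟨y, hy, rfl⟩), hg y⟩
    exact h1 (M.span_eq_top ▸ Submodule.mem_top)
  obtain ⟨b, hb, hba⟩ := hfa
  have h2 : a - b ∈ LinearMap.ker f.toLinearMap := by
    rw [LinearMap.mem_ker, map_sub, hba]
    exact sub_self _
  have := Submodule.add_mem _ (hker h2) hb
  rwa [sub_add_cancel] at this

/-- A `Λ`-submodule `N` of `A` with an inverse `P` generates `A`: its `ℚ`-span is an ideal which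
contains `1`, as `1 ∈ N P`. -/
theorem IsOrder.span_eq_top_of_mul_eq {Λ : FullLattice A} (hΛ : Λ.IsOrder) {N P : Submodule ℤ A}
    (hN : Λ.toSubmodule * N = N) (hNP : N * P = Λ.toSubmodule) :
    Submodule.span ℚ (N : Set A) = ⊤ := by
  have hstab : ∀ a : A, ∀ z ∈ Submodule.span ℚ (N : Set A),
      a * z ∈ Submodule.span ℚ (N : Set A) := by
    intro a z hz
    have ha : a ∈ Submodule.span ℚ (Λ.toSubmodule : Set A) := Λ.span_eq_top ▸ Submodule.mem_top
    have h := Submodule.mul_mem_mul ha hz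
    rw [Submodule.span_mul_span] at h
    refine Submodule.span_mono ?_ h
    rintro _ ⟨l, hl, m, hm, rfl⟩
    have := Submodule.mul_mem_mul (M := Λ.toSubmodule) hl hm
    rwa [hN] at this
  have h1 : (1 : A) ∈ N * P := hNP ▸ hΛ.one_mem
  obtain ⟨m, p, q, hp, hq, hpq⟩ := Submodule.exists_sum_of_mem_mul h1
  rw [eq_top_iff]
  intro a _
  rw [← mul_one a, ← hpq]
  refine hstab _ _ (Submodule.sum_mem _ fun i _ => ?_)
  rw [mul_comm]
  exact hstab _ _ (Submodule.subset_span (hp i))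

/-- Invertible lattices lift along `f`: if `1 = ∑ xᵢ yᵢ` with `xᵢ` in the lattice and `yⱼ` in its
inverse, then `(xᵢ yⱼ)` is an idempotent matrix over `f(Λ)`. It lifts to an idempotent matrix
`(vᵢ wⱼ)` over `Λ`, and `∑ Λ vᵢ` is the required lattice. -/
theorem exists_isInvertibleAt_map_eq [FiniteDimensional ℚ A] (f : A →ₐ[ℚ] B)
    (hf : Function.Surjective f) (hnil : ∀ x, f x = 0 → IsNilpotent x) {Λ : FullLattice A}
    (hΛ : Λ.IsOrder) {L' : FullLattice B} (hL' : IsInvertibleAt (map f hf Λ) L') :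
    ∃ L, IsInvertibleAt Λ L ∧ map f hf L = L' := by
  have : IsNoetherianRing A := IsNoetherianRing.of_finite ℚ A
  obtain ⟨hL, M', hM⟩ := hL'
  have h1 : (1 : B) ∈ L'.toSubmodule * M'.toSubmodule := by
    have := (hΛ.map f hf).one_mem
    rwa [← hM] at this
  obtain ⟨n, x, y, hx, hy, hxy⟩ := Submodule.exists_sum_of_mem_mul h1
  have hyx : y ⬝ᵥ x = 1 := by rw [← hxy]; exact Finset.sum_congr rfl fun i _ => mul_comm _ _
  have he : IsIdempotentElem (Matrix.vecMulVec x y) := by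
    rw [IsIdempotentElem, Matrix.vecMulVec_mul_vecMulVec, hyx, one_smul]
  obtain ⟨E, hE, hES, hEe⟩ := exists_isIdempotentElem_matrix_lift (f : A →+* B) hnil hΛ.toSubring he
    (fun i j => by
      have : x i * y j ∈ (map f hf Λ).toSubmodule := hM ▸ mul_mem_mul (hx i) (hy j)
      exact this)
  obtain ⟨v, w, hv, hwv, hEvw⟩ := exists_rank_one_lift (f : A →+* B) hf hnil hE x y hyx hEe
  have hvw : ∀ i j, v i * w j ∈ Λ.toSubmodule := fun i j => by
    have := hES i j
    rwa [hEvw] at this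
  -- The lattices `∑ Λ vᵢ` and `∑ Λ wⱼ` are mutually inverse.
  have hΛΛ : Λ.toSubmodule * Λ.toSubmodule = Λ.toSubmodule :=
    congrArg toSubmodule hΛ.isIdempotentElem.eq
  have hprod : (Λ.toSubmodule * Submodule.span ℤ (Set.range v)) *
      (Λ.toSubmodule * Submodule.span ℤ (Set.range w)) = Λ.toSubmodule := by
    rw [mul_mul_mul_comm, hΛΛ, Submodule.span_mul_span]
    refine le_antisymm ?_ fun a ha => ?_
    · conv_rhs => rw [← hΛΛ]
      refine mul_le_mul' le_rfl (Submodule.span_le.2 ?_)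
      rintro _ ⟨_, ⟨i, rfl⟩, _, ⟨j, rfl⟩, rfl⟩
      exact hvw i j
    · rw [← mul_one a, ← hwv]
      refine Submodule.mul_mem_mul ha (Submodule.sum_mem _ fun i _ => Submodule.subset_span ?_)
      exact ⟨v i, ⟨i, rfl⟩, w i, ⟨i, rfl⟩, mul_comm _ _⟩
  have hstab : ∀ N : Submodule ℤ A, Λ.toSubmodule * (Λ.toSubmodule * N) = Λ.toSubmodule * N :=
    fun N => by rw [← mul_assoc, hΛΛ]
  refine ⟨⟨Λ.toSubmodule * Submodule.span ℤ (Set.range v),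
      Λ.fg.mul (Submodule.fg_span (Set.finite_range v)), hΛ.span_eq_top_of_mul_eq (hstab _) hprod⟩,
    ⟨FullLattice.ext ?_, ⟨⟨Λ.toSubmodule * Submodule.span ℤ (Set.range w),
      Λ.fg.mul (Submodule.fg_span (Set.finite_range w)),
      hΛ.span_eq_top_of_mul_eq (hstab _) ((mul_comm _ _).trans hprod)⟩,
      FullLattice.ext hprod⟩⟩, FullLattice.ext ?_⟩
  · rw [toSubmodule_mul, mul_right_comm, hΛΛ]
  · -- `f(∑ Λ vᵢ) = ∑ f(Λ) xᵢ = L'`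
    have hmap : ((Λ.toSubmodule * Submodule.span ℤ (Set.range v)).map
        f.toRingHom.toIntAlgHom.toLinearMap) =
        (map f hf Λ).toSubmodule * Submodule.span ℤ (Set.range x) := by
      rw [Submodule.map_mul, Submodule.map_span, ← Set.range_comp]
      congr 3
      funext i
      exact hv i
    refine hmap.trans (le_antisymm ?_ fun a ha => ?_)
    · conv_rhs => rw [← hL, mul_comm, toSubmodule_mul]
      refine mul_le_mul' le_rfl (Submodule.span_le.2 ?_)
      rintro _ ⟨i, rfl⟩
      exact hx i
    · rw [← mul_one a, ← hyx, dotProduct, Finset.mul_sum]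
      refine Submodule.sum_mem _ fun i _ => ?_
      rw [← mul_assoc]
      refine Submodule.mul_mem_mul ?_ (Submodule.subset_span ⟨i, rfl⟩)
      rw [← hM]
      exact mul_mem_mul ha (hy i)

/-- An invertible lattice over `Λ` whose image is `f(Λ)` is of the form `x Λ`, for each `x ∈ L`
over `1`. -/
theorem exists_unitMul_eq_of_map_eq (f : A →ₐ[ℚ] B)
    (hf : Function.Surjective f) (hnil : ∀ x, f x = 0 → IsNilpotent x) {Λ : FullLattice A}
    (hΛ : Λ.IsOrder) {L : FullLattice A} (hL : IsInvertibleAt Λ L)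
    (hfL : map f hf L = map f hf Λ) : ∃ a : Aˣ, unitMul a Λ.toSubmodule = L.toSubmodule := by
  obtain ⟨hLΛ, M, hM⟩ := hL
  have hfM : map f hf (M * Λ) = map f hf Λ := by
    rw [map_mul, mul_comm, ← hfL, ← map_mul, hM, hfL]
  have h1 := (hΛ.map f hf).one_mem
  obtain ⟨x, hx, hx1⟩ : (1 : B) ∈ (map f hf L).toSubmodule := hfL ▸ h1
  obtain ⟨y, hy, hy1⟩ : (1 : B) ∈ (map f hf (M * Λ)).toSubmodule := hfM ▸ h1
  have hLMΛ : L * (M * Λ) = Λ := by rw [← mul_assoc, hM, hΛ.isIdempotentElem.eq]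
  replace hx1 : f x = 1 := hx1
  replace hy1 : f y = 1 := hy1
  have hxy : x * y ∈ Λ.toSubmodule := hLMΛ ▸ mul_mem_mul hx hy
  -- `x y` is a unit of `Λ`, not only of `A`: it is `1` plus a nilpotent element of `Λ`.
  have hnil' : IsNilpotent (x * y - 1) :=
    hnil _ (by rw [map_sub, map_mul, hx1, hy1, map_one, mul_one, sub_self])
  obtain ⟨z, hz, hxyz⟩ : ∃ z ∈ Λ.toSubmodule, x * y * z = 1 := by
    have h : IsNilpotent ((⟨x * y, hxy⟩ : hΛ.toSubring) - 1) := by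
      refine (IsNilpotent.map_iff (f := hΛ.toSubring.subtype) Subtype.val_injective).1 ?_
      exact hnil'
    have h2 := h.isUnit_one_add
    rw [add_sub_cancel] at h2
    obtain ⟨z, hz⟩ := h2.exists_right_inv
    exact ⟨z, z.2, congrArg Subtype.val hz⟩
  refine ⟨Units.mkOfMulEqOne x (y * z) (by rw [← mul_assoc, hxyz]), ?_⟩
  ext l
  rw [mem_unitMul]
  constructor
  · rintro ⟨t, ht, rfl⟩
    have := mul_mem_mul hx ht
    rwa [hLΛ] at this
  · intro hl
    refine ⟨y * l * z, ?_, ?_⟩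
    · refine hΛ.mul_le (mul_mem_mul ?_ hz)
      rw [mul_comm y, ← hLMΛ]
      exact mul_mem_mul hl hy
    · change x * (y * l * z) = l
      rw [show x * (y * l * z) = x * y * z * l by ring, hxyz, one_mul]

/-- The lattice `a L` for a unit `a`. -/
def smulUnit (a : Aˣ) (L : FullLattice A) : FullLattice A where
  toSubmodule := unitMul a L.toSubmodule
  fg := L.fg.map _
  span_eq_top := by
    have h := congrArg (Submodule.map (LinearMap.mulLeft ℚ (a : A))) L.span_eq_top
    rw [Submodule.map_span, Submodule.map_top, LinearMap.range_eq_top.2] at h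
    · exact h
    · intro x
      exact ⟨↑a⁻¹ * x, by simp⟩

theorem smulUnit_mul (a : Aˣ) (L M : FullLattice A) : smulUnit a (L * M) = smulUnit a L * M := by
  refine FullLattice.ext ?_
  have h := unitMul_mul a 1 L.toSubmodule M.toSubmodule
  have h1 : unitMul 1 M.toSubmodule = M.toSubmodule := by ext x; simp [mem_unitMul]
  rwa [mul_one, h1] at h

theorem mk_smulUnit (a : Aˣ) (L : FullLattice A) : EpsClass.mk (smulUnit a L) = EpsClass.mk L :=
  ((Con.eq _).2 ⟨a, rfl⟩ : EpsClass.mk L = EpsClass.mk (smulUnit a L)).symm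

end FullLattice

namespace EpsClass

open FullLattice

variable {A B : Type*} [CommRing A] [Algebra ℚ A] [CommRing B] [Algebra ℚ B]

theorem mk_surjective : Function.Surjective (mk : FullLattice A → EpsClass A) :=
  Quotient.mk''_surjective

theorem mk_eq_mk_iff {L M : FullLattice A} : mk L = mk M ↔ ∃ a : Aˣ, smulUnit a L = M := by
  refine (Con.eq (FullLattice.epsCon A)).trans ⟨?_, ?_⟩
  · rintro ⟨a, h⟩
    exact ⟨a, FullLattice.ext h⟩
  · rintro ⟨a, rfl⟩
    exact ⟨a, rfl⟩

/-- A class fixed by `[Λ]` contains a lattice `L` with `L Λ = L` on the nose: replace any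
representative `L` by `L Λ`. -/
theorem exists_mk_eq_of_mul_eq {Λ : FullLattice A} (hΛ : Λ.IsOrder) {x : EpsClass A}
    (hx : x * mk Λ = x) : ∃ L, mk L = x ∧ L * Λ = L := by
  obtain ⟨L, rfl⟩ := mk_surjective x
  exact ⟨L * Λ, hx, by rw [mul_assoc, hΛ.isIdempotentElem.eq]⟩

/-- Each class in `G([Λ])` is the class of a lattice in `G(Λ)`. -/
theorem exists_isInvertibleAt_mk_eq {Λ : FullLattice A} (hΛ : Λ.IsOrder) {x : EpsClass A}
    (hx : IsInvertibleAt (mk Λ) x) : ∃ L, mk L = x ∧ IsInvertibleAt Λ L := by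
  obtain ⟨hx, y, hy⟩ := hx
  obtain ⟨L, rfl, hL⟩ := exists_mk_eq_of_mul_eq hΛ hx
  obtain ⟨M, rfl⟩ := mk_surjective y
  obtain ⟨a, ha⟩ := mk_eq_mk_iff.1 ((mk_mul L M).trans hy)
  refine ⟨L, rfl, hL, smulUnit a M, ?_⟩
  rw [mul_comm, ← smulUnit_mul, mul_comm, ha]

theorem map_surjective [FiniteDimensional ℚ A] (f : A →ₐ[ℚ] B) (hf : Function.Surjective f) :
    Function.Surjective (map f hf) := by
  intro x
  obtain ⟨M, rfl⟩ := mk_surjective x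
  obtain ⟨L, rfl⟩ := FullLattice.map_surjective f hf M
  exact ⟨mk L, rfl⟩

theorem exists_isInvertibleAt_map_eq [FiniteDimensional ℚ A] (f : A →ₐ[ℚ] B)
    (hf : Function.Surjective f) (hnil : ∀ x, f x = 0 → IsNilpotent x) {Λ : FullLattice A}
    (hΛ : Λ.IsOrder) {x : EpsClass B} (hx : IsInvertibleAt (mk (FullLattice.map f hf Λ)) x) :
    ∃ y, IsInvertibleAt (mk Λ) y ∧ map f hf y = x := by
  obtain ⟨L', rfl, hL'⟩ := exists_isInvertibleAt_mk_eq (hΛ.map f hf) hx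
  obtain ⟨L, ⟨hL, M, hM⟩, rfl⟩ := FullLattice.exists_isInvertibleAt_map_eq f hf hnil hΛ hL'
  exact ⟨mk L, ⟨by rw [← mk_mul, hL], mk M, by rw [← mk_mul, hM]⟩, rfl⟩

/-- The homomorphism `G([Λ]) → G([f(Λ)])` has trivial kernel. -/
theorem eq_mk_of_map_eq (f : A →ₐ[ℚ] B)
    (hf : Function.Surjective f) (hnil : ∀ x, f x = 0 → IsNilpotent x) {Λ : FullLattice A}
    (hΛ : Λ.IsOrder) {x : EpsClass A} (hx : IsInvertibleAt (mk Λ) x)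
    (hfx : map f hf x = mk (FullLattice.map f hf Λ)) : x = mk Λ := by
  obtain ⟨L, rfl, hL, M, hM⟩ := exists_isInvertibleAt_mk_eq hΛ hx
  obtain ⟨b, hb⟩ := mk_eq_mk_iff.1 hfx
  obtain ⟨a, ha⟩ := hf b
  obtain ⟨u, rfl⟩ := isUnit_of_isUnit_map_of_ker_nil (f : A →+* B) hf hnil (a := a)
    (by rw [RingHom.coe_coe, ha]; exact b.isUnit)
  -- Up to the unit `u`, the image of `L` is `f(Λ)`.
  have hfL : FullLattice.map f hf (smulUnit u L) = FullLattice.map f hf Λ := by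
    rw [← hb]
    ext z
    constructor
    · rintro ⟨_, ⟨l, hl, rfl⟩, rfl⟩
      exact ⟨f l, ⟨l, hl, rfl⟩, by rw [← ha]; exact (map_mul f _ _).symm⟩
    · rintro ⟨_, ⟨l, hl, rfl⟩, rfl⟩
      exact ⟨u * l, ⟨l, hl, rfl⟩, by rw [← ha]; exact map_mul f _ _⟩
  have hinv : IsInvertibleAt Λ (smulUnit u L) := by
    refine ⟨by rw [← smulUnit_mul, hL], smulUnit u⁻¹ M, ?_⟩
    rw [← smulUnit_mul, mul_comm, ← smulUnit_mul, mul_comm, hM]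
    ext z
    simp [smulUnit, mem_unitMul]
  obtain ⟨c, hc⟩ := exists_unitMul_eq_of_map_eq f hf hnil hΛ hinv hfL
  rw [← mk_smulUnit u L]
  exact (mk_eq_mk_iff.2 ⟨c, FullLattice.ext hc⟩).symm

end EpsClass

/-! ### Lattices between two commensurable lattices -/

theorem Submodule.FG.finite_setOf_smul_mem_le {M : Type*} [AddCommGroup M] {J : Submodule ℤ M}
    (hJ : J.FG) {n : ℤ} (hn : n ≠ 0) :
    {N : Submodule ℤ M | (∀ x ∈ J, n • x ∈ N) ∧ N ≤ J}.Finite := by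
  have : Module.Finite ℤ J := Module.Finite.iff_fg.2 hJ
  set S : Submodule ℤ J := LinearMap.range (LinearMap.lsmul ℤ J n) with hS
  have : Finite (J ⧸ S) := by
    refine Module.finite_of_fg_torsion _ fun q => ?_
    obtain ⟨x, rfl⟩ := S.mkQ_surjective q
    refine ⟨⟨n, mem_nonZeroDivisors_of_ne_zero hn⟩, ?_⟩
    change n • S.mkQ x = 0
    rw [← map_smul, Submodule.mkQ_apply, Submodule.Quotient.mk_eq_zero]
    exact ⟨x, rfl⟩
  have : Finite (Submodule ℤ (J ⧸ S)) := Finite.of_injective _ SetLike.coe_injective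
  refine (Set.finite_range fun Q : Submodule ℤ (J ⧸ S) => (Q.comap S.mkQ).map J.subtype).subset ?_
  rintro N ⟨h1, h2⟩
  have hSN : S ≤ N.comap J.subtype := by
    rintro _ ⟨x, rfl⟩
    exact h1 x x.2
  refine ⟨(N.comap J.subtype).map S.mkQ, ?_⟩
  change ((((N.comap J.subtype).map S.mkQ).comap S.mkQ).map J.subtype) = N
  rw [Submodule.comap_map_mkQ, sup_eq_right.2 hSN, Submodule.map_comap_subtype, inf_eq_right.2 h2]

namespace FullLattice

variable {A : Type*} [CommRing A] [Algebra ℚ A]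

theorem exists_smul_mem (M : FullLattice A) (x : A) : ∃ n : ℤ, n ≠ 0 ∧ n • x ∈ M.toSubmodule := by
  have hx : x ∈ Submodule.span ℚ (M.toSubmodule : Set A) := M.span_eq_top ▸ Submodule.mem_top
  induction hx using Submodule.span_induction with
  | mem x hx => exact ⟨1, one_ne_zero, by simpa using hx⟩
  | zero => exact ⟨1, one_ne_zero, by simp⟩
  | add x y _ _ ihx ihy =>
    obtain ⟨n, hn, hnx⟩ := ihx
    obtain ⟨m, hm, hmy⟩ := ihy
    refine ⟨n * m, mul_ne_zero hn hm, ?_⟩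
    rw [smul_add, mul_comm, mul_smul, mul_comm, mul_smul]
    exact M.toSubmodule.add_mem (M.toSubmodule.smul_mem _ hnx) (M.toSubmodule.smul_mem _ hmy)
  | smul q x _ ih =>
    obtain ⟨n, hn, hnx⟩ := ih
    refine ⟨n * q.den, mul_ne_zero hn (by exact_mod_cast q.den_ne_zero), ?_⟩
    have h : (n * q.den : ℤ) • q • x = q.num • n • x := by
      rw [← Int.cast_smul_eq_zsmul ℚ, ← Int.cast_smul_eq_zsmul ℚ q.num,
        ← Int.cast_smul_eq_zsmul ℚ n, smul_smul, smul_smul]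
      congr 1
      push_cast
      rw [mul_assoc, Rat.den_mul_eq_num, mul_comm]
    rw [h]
    exact M.toSubmodule.smul_mem _ hnx

theorem exists_forall_smul_mem (L M : FullLattice A) :
    ∃ n : ℤ, n ≠ 0 ∧ ∀ x ∈ L.toSubmodule, n • x ∈ M.toSubmodule := by
  obtain ⟨s, hs⟩ := L.fg
  choose n hn hnM using M.exists_smul_mem
  refine ⟨∏ x ∈ s, n x, Finset.prod_ne_zero_iff.2 fun x _ => hn x, ?_⟩
  intro x hx
  rw [← hs] at hx
  induction hx using Submodule.span_induction with
  | mem x hx =>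
    obtain ⟨k, hk⟩ := Finset.dvd_prod_of_mem n hx
    rw [hk, mul_comm, mul_smul]
    exact M.toSubmodule.smul_mem _ (hnM x)
  | zero => simp
  | add x y _ _ ihx ihy => rw [smul_add]; exact M.toSubmodule.add_mem ihx ihy
  | smul r x _ ih => rw [smul_comm]; exact M.toSubmodule.smul_mem _ ih

end FullLattice

namespace EpsClass

open FullLattice

variable {A : Type*} [CommRing A] [Algebra ℚ A]

/-- Finiteness of the set of classes of `Λ`-lattices does not depend on the order `Λ`. If
`n O ⊆ Λ` with `n ≠ 0`, then a `Λ`-lattice `L` lies between `n L O` and `L O`, so the map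
`[L] ↦ [L O]` from classes of `Λ`-lattices to classes of `O`-lattices has finite fibres. -/
theorem finite_setOf_mul_mk_eq {O Λ : FullLattice A} (hO : O.IsOrder) (hΛ : Λ.IsOrder)
    (h : {x : EpsClass A | x * mk O = x}.Finite) : {x : EpsClass A | x * mk Λ = x}.Finite := by
  refine Set.Finite.of_finite_fibers (· * mk O) (h.subset ?_) ?_
  · rintro _ ⟨x, -, rfl⟩
    change x * mk O * mk O = x * mk O
    rw [mul_assoc, (isIdempotentElem_mk hO).eq]
  · rintro _ ⟨x₀, -, rfl⟩
    obtain ⟨L₀, rfl⟩ := mk_surjective x₀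
    obtain ⟨n, hn, hnO⟩ := exists_forall_smul_mem O Λ
    have hfin := ((L₀ * O).fg.finite_setOf_smul_mem_le hn).preimage
      (f := (toSubmodule : FullLattice A → _)) (fun L _ M _ h => FullLattice.ext h)
    refine (hfin.image mk).subset ?_
    rintro x ⟨hx, hx'⟩
    obtain ⟨L, rfl, hL⟩ := exists_mk_eq_of_mul_eq hΛ hx
    obtain ⟨a, ha⟩ := mk_eq_mk_iff.1 (((mk_mul L O).trans hx').trans (mk_mul L₀ O).symm)
    have hLa : smulUnit a L * Λ = smulUnit a L := by rw [← smulUnit_mul, hL]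
    rw [smulUnit_mul] at ha
    refine ⟨smulUnit a L, ⟨fun z hz => ?_, fun z hz => ?_⟩, mk_smulUnit a L⟩
    · rw [← ha] at hz
      induction hz using Submodule.mul_induction_on' with
      | mem_mul_mem l hl o ho =>
        rw [← mul_smul_comm, ← hLa]
        exact mul_mem_mul hl (hnO o ho)
      | add y _ z _ ihy ihz => rw [smul_add]; exact Submodule.add_mem _ ihy ihz
    · rw [← ha, ← mul_one z]
      exact mul_mem_mul hz hO.one_mem

end EpsClass

/-! ### Lattices over a maximal order -/

open scoped nonZeroDivisors in
/-- Nonzero finitely generated submodules of the fraction field of a Dedekind domain are classified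
up to multiplication by scalars by the class group. -/
theorem exists_classGroup_invariant (R K : Type*) [CommRing R] [IsDedekindDomain R]
    [Field K] [Algebra R K] [IsFractionRing R K] :
    ∃ c : Submodule R K → ClassGroup R, ∀ I J : Submodule R K, I.FG → J.FG → I ≠ ⊥ → J ≠ ⊥ →
      c I = c J → ∃ a : K, a ≠ 0 ∧ ∀ x, x ∈ J ↔ ∃ y ∈ I, a * y = x := by
  classical
  let F : (I : Submodule R K) → I.FG → FractionalIdeal R⁰ K := fun I h =>
    ⟨I, FractionalIdeal.isFractional_of_fg h⟩
  have hF : ∀ I h, I ≠ ⊥ → F I h ≠ 0 := fun I h hI h0 =>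
    hI (by simpa [F] using congrArg (fun J : FractionalIdeal R⁰ K => (J : Submodule R K)) h0)
  refine ⟨fun I => if h : I.FG ∧ I ≠ ⊥ then
    ClassGroup.mk K (Units.mk0 (F I h.1) (hF I h.1 h.2)) else 1, ?_⟩
  intro I J hI hJ hI0 hJ0 h
  simp only [dif_pos (And.intro hI hI0), dif_pos (And.intro hJ hJ0)] at h
  have h1 := h.symm
  rw [← div_eq_one, ← map_div, ClassGroup.mk_eq_one_iff] at h1
  obtain ⟨a, ha⟩ := (FractionalIdeal.isPrincipal_iff _).1 h1
  have hJI : F J hJ = FractionalIdeal.spanSingleton R⁰ a * F I hI := by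
    rw [← ha, Units.val_div_eq_div_val, Units.val_mk0, Units.val_mk0,
      div_mul_cancel₀ _ (hF I hI hI0)]
  refine ⟨a, ?_, fun x => ?_⟩
  · rintro rfl
    rw [FractionalIdeal.spanSingleton_zero, zero_mul] at hJI
    exact hF J hJ hJ0 hJI
  · have hx : x ∈ J ↔ x ∈ F J hJ := Iff.rfl
    rw [hx, hJI, FractionalIdeal.mem_singleton_mul]
    exact ⟨fun ⟨y, hy, h⟩ => ⟨y, hy, h.symm⟩, fun ⟨y, hy, h⟩ => ⟨y, hy, h.symm⟩⟩

section ProductOfNumberFields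

open NumberField FullLattice

variable {F : Type*} [CommRing F] [Algebra ℚ F] {ι : Type*} [Finite ι]
  {K : ι → Type*} [∀ i, Field (K i)] [∀ i, NumberField (K i)]

/-- The maximal order of an algebra isomorphic to a product of number fields: the preimage of the
product of the rings of integers. -/
noncomputable def maxOrder [FiniteDimensional ℚ F] (e : F ≃+* ∀ i, K i) : FullLattice F where
  toSubmodule := LinearMap.range
    (e.symm.toAddEquiv.toIntLinearEquiv.toLinearMap ∘ₗ
      LinearMap.pi fun i => (Algebra.linearMap (𝓞 (K i)) (K i)).restrictScalars ℤ ∘ₗ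
        LinearMap.proj i)
  fg := Module.Finite.iff_fg.1 (Module.Finite.range _)
  span_eq_top := by
    rw [eq_top_iff]
    intro x _
    have halg : IsAlgebraic ℤ x :=
      (IsFractionRing.isAlgebraic_iff ℤ ℚ F).2 (IsAlgebraic.of_finite ℚ x)
    obtain ⟨n, hn, hx⟩ := halg.exists_integral_multiple
    have hmem : ∀ i, IsIntegral ℤ (e (n • x) i) := fun i =>
      hx.map ((Pi.evalRingHom K i).comp e.toRingHom).toIntAlgHom
    have hx' : n • x = (n : ℚ) • x := (Int.cast_smul_eq_zsmul ℚ n x).symm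
    have h : x = (n : ℚ)⁻¹ • (n • x) := by
      rw [hx', smul_smul, inv_mul_cancel₀ (by exact_mod_cast hn), one_smul]
    rw [h]
    refine Submodule.smul_mem _ _ (Submodule.subset_span ⟨fun i => ⟨_, hmem i⟩, ?_⟩)
    exact e.symm_apply_apply _

variable [FiniteDimensional ℚ F] (e : F ≃+* ∀ i, K i)

theorem mem_maxOrder (x : F) :
    x ∈ (maxOrder e).toSubmodule ↔ ∀ i, ∃ r : 𝓞 (K i), (r : K i) = e x i := by
  constructor
  · rintro ⟨r, rfl⟩ i
    exact ⟨r i, (congrFun (e.apply_symm_apply fun i => (r i : K i)) i).symm⟩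
  · intro h
    choose r hr using h
    refine ⟨r, ?_⟩
    have : (fun i => (r i : K i)) = e x := funext hr
    exact (congrArg e.symm this).trans (e.symm_apply_apply x)

theorem maxOrder_isOrder : (maxOrder e).IsOrder where
  one_mem := (mem_maxOrder e 1).2 fun i => ⟨1, by simp⟩
  mul_le := Submodule.mul_le.2 fun x hx y hy => (mem_maxOrder e _).2 fun i => by
    obtain ⟨r, hr⟩ := (mem_maxOrder e x).1 hx i
    obtain ⟨s, hs⟩ := (mem_maxOrder e y).1 hy i
    exact ⟨r * s, by simp [hr, hs]⟩

/-- The `𝓞 (K i)`-submodule of `K i` generated by the image of the lattice `L` in the `i`-th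
factor. If `L` is a lattice over the maximal order, this is the image itself, see
`mem_component_iff`. -/
def component (L : FullLattice F) (i : ι) : Submodule (𝓞 (K i)) (K i) :=
  Submodule.span (𝓞 (K i)) ((fun x => e x i) '' L.toSubmodule)

omit [Finite ι] [∀ i, NumberField (K i)] [FiniteDimensional ℚ F] in
theorem component_fg (L : FullLattice F) (i : ι) : (component e L i).FG := by
  obtain ⟨s, hs⟩ := L.fg
  have h : component e L i = Submodule.span (𝓞 (K i)) ((fun x => e x i) '' s) := by
    refine le_antisymm (Submodule.span_le.2 ?_)
      (Submodule.span_mono (Set.image_mono (hs ▸ Submodule.subset_span)))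
    rintro _ ⟨x, hx, rfl⟩
    rw [← hs] at hx
    induction hx using Submodule.span_induction with
    | mem x hx => exact Submodule.subset_span ⟨x, hx, rfl⟩
    | zero => simp
    | add x y _ _ ihx ihy => simpa using Submodule.add_mem _ ihx ihy
    | smul r x _ ih =>
      simp only [map_zsmul, Pi.smul_apply]
      exact zsmul_mem ih r
  rw [h]
  exact Submodule.fg_span (s.finite_toSet.image _)

omit [Finite ι] [FiniteDimensional ℚ F] in
theorem component_ne_bot (L : FullLattice F) (i : ι) : component e L i ≠ ⊥ := by
  intro h
  have h0 : ∀ x ∈ L.toSubmodule, e x i = 0 := fun x hx => by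
    have : e x i ∈ component e L i := Submodule.subset_span ⟨x, hx, rfl⟩
    rwa [h, Submodule.mem_bot] at this
  obtain ⟨n, hn, hn1⟩ := L.exists_smul_mem 1
  have := h0 _ hn1
  simp [hn] at this

variable {e}

theorem mem_component_iff {L : FullLattice F} (hL : L * maxOrder e = L) (i : ι) (y : K i) :
    y ∈ component e L i ↔ ∃ x ∈ L.toSubmodule, e x i = y := by
  classical
  refine ⟨fun hy => ?_, fun ⟨x, hx, h⟩ => Submodule.subset_span ⟨x, hx, h⟩⟩
  induction hy using Submodule.span_induction with
  | mem y hy => exact hy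
  | zero => exact ⟨0, L.toSubmodule.zero_mem, by simp⟩
  | add y z _ _ ihy ihz =>
    obtain ⟨x, hx, rfl⟩ := ihy
    obtain ⟨x', hx', rfl⟩ := ihz
    exact ⟨x + x', L.toSubmodule.add_mem hx hx', by simp⟩
  | smul r y _ ih =>
    obtain ⟨x, hx, rfl⟩ := ih
    refine ⟨x * e.symm (Pi.single i (r : K i)), ?_, by simp [mul_comm, Algebra.smul_def]⟩
    rw [← hL]
    refine mul_mem_mul hx ((mem_maxOrder e _).2 fun j => ?_)
    rw [e.apply_symm_apply]
    obtain rfl | hj := eq_or_ne j i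
    · exact ⟨r, by simp⟩
    · exact ⟨0, by simp [hj]⟩

/-- A lattice over the maximal order is the product of its components. -/
theorem mem_iff_forall_mem_component {L : FullLattice F} (hL : L * maxOrder e = L) (x : F) :
    x ∈ L.toSubmodule ↔ ∀ i, e x i ∈ component e L i := by
  classical
  refine ⟨fun hx i => Submodule.subset_span ⟨x, hx, rfl⟩, fun h => ?_⟩
  have := Fintype.ofFinite ι
  have hsum : x = ∑ i, e.symm (Pi.single i (e x i)) := by
    rw [← map_sum, Finset.univ_sum_single, e.symm_apply_apply]
  rw [hsum]
  refine Submodule.sum_mem _ fun i _ => ?_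
  obtain ⟨z, hz, hzi⟩ := (mem_component_iff hL i _).1 (h i)
  have hmul : e.symm (Pi.single i (e x i)) = z * e.symm (Pi.single i 1) := by
    apply e.injective
    rw [map_mul, e.apply_symm_apply, e.apply_symm_apply, ← hzi]
    ext j
    obtain rfl | hj := eq_or_ne j i
    · simp
    · simp [hj]
  rw [hmul, ← hL]
  refine mul_mem_mul hz ((mem_maxOrder e _).2 fun j => ?_)
  rw [e.apply_symm_apply]
  obtain rfl | hj := eq_or_ne j i
  · exact ⟨1, by simp⟩
  · exact ⟨0, by simp [hj]⟩

variable (e)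

/-- Lattices over the maximal order are classified up to units by the classes of their components
in the class groups of the factors. -/
theorem finite_setOf_mul_mk_maxOrder_eq :
    {x : EpsClass F | x * EpsClass.mk (maxOrder e) = x}.Finite := by
  choose c hc using fun i => exists_classGroup_invariant (𝓞 (K i)) (K i)
  choose L hLx hL using fun x : {x : EpsClass F // x * EpsClass.mk (maxOrder e) = x} =>
    EpsClass.exists_mk_eq_of_mul_eq (maxOrder_isOrder e) x.2
  refine @Set.toFinite _ _ (Finite.of_injective (β := ∀ i, ClassGroup (𝓞 (K i)))
    (fun x i => c i (component e (L x) i)) fun x y hxy => ?_)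
  choose a ha0 ha using fun i => hc i _ _ (component_fg e (L x) i) (component_fg e (L y) i)
    (component_ne_bot e _ i) (component_ne_bot e _ i) (congrFun hxy i)
  refine Subtype.ext ?_
  rw [← hLx x, ← hLx y, EpsClass.mk_eq_mk_iff]
  have hunit : e.symm a * e.symm (fun i => (a i)⁻¹) = 1 := by
    rw [← map_mul, ← map_one e.symm]
    congr 1
    funext i
    exact mul_inv_cancel₀ (ha0 i)
  refine ⟨Units.mkOfMulEqOne _ _ hunit, FullLattice.ext ?_⟩
  ext z
  rw [mem_iff_forall_mem_component (hL y)]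
  constructor
  · rintro ⟨l, hl, rfl⟩ i
    refine (ha i _).2 ⟨e l i, (mem_iff_forall_mem_component (hL x) l).1 hl i, ?_⟩
    simp
  · intro h
    choose t ht hat using fun i => (ha i _).1 (h i)
    refine ⟨e.symm t, (mem_iff_forall_mem_component (hL x) _).2 fun i => ?_, ?_⟩
    · rw [e.apply_symm_apply]
      exact ht i
    · apply e.injective
      funext i
      simp [hat]

end ProductOfNumberFields

theorem NumberField.of_surjective {F K : Type*} [CommRing F] [Algebra ℚ F]
    [FiniteDimensional ℚ F] [Field K] [CharZero K] (f : F →+* K) (hf : Function.Surjective f) :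
    NumberField K where
  to_charZero := inferInstance
  to_finiteDimensional := Module.Finite.of_surjective f.toAddMonoidHom.toRatLinearMap hf

/-- A form of the Jordan–Zassenhaus theorem: in a reduced finite dimensional algebra there are only
finitely many classes of lattices over an order. -/
theorem FullLattice.IsOrder.finite_setOf_mul_mk_eq {F : Type*} [CommRing F] [Algebra ℚ F]
    [FiniteDimensional ℚ F] [IsReduced F] {Λ : FullLattice F} (hΛ : Λ.IsOrder) :
    {x : EpsClass F | x * EpsClass.mk Λ = x}.Finite := by
  have : IsArtinianRing F := IsArtinianRing.of_finite ℚ F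
  let K : MaximalSpectrum F → Type _ := fun m => F ⧸ m.asIdeal
  let : ∀ m, Field (K m) := fun m => Ideal.Quotient.field m.asIdeal
  have hchar : ∀ m, CharZero (K m) := fun m =>
    charZero_of_injective_algebraMap (algebraMap ℚ (F ⧸ m.asIdeal)).injective
  have : ∀ m, NumberField (K m) := fun m =>
    NumberField.of_surjective (Ideal.Quotient.mk m.asIdeal) Ideal.Quotient.mk_surjective
  let e : F ≃+* ∀ m, K m := (IsArtinianRing.equivPi F).toRingEquiv
  exact EpsClass.finite_setOf_mul_mk_eq (maxOrder_isOrder e) hΛ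
    (finite_setOf_mul_mk_maxOrder_eq e)

theorem EpsClass.finite_epsGroup {F : Type*} [CommRing F] [Algebra ℚ F] [FiniteDimensional ℚ F]
    [IsReduced F] {Λ : FullLattice F} (hΛ : Λ.IsOrder) : Finite (epsGroup Λ hΛ) := by
  have := hΛ.finite_setOf_mul_mk_eq.to_subtype
  exact Finite.of_injective
    (fun x : epsGroup Λ hΛ => (⟨x.1, x.2.1⟩ : {x : EpsClass F | x * EpsClass.mk Λ = x}))
    fun x y h => Subtype.ext (Subtype.mk.inj h)

/-! ### The projection to the separable part -/

section SeparablePart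

variable (A : Type*) [CommRing A] [Algebra ℚ A] [FiniteDimensional ℚ A]

theorem isNilpotent_of_prF_eq_zero (x : A) (hx : prF A x = 0) : IsNilpotent x :=
  (Submodule.projectionOnto_apply_eq_zero_iff (isCompl_sepPart_radPart A)).1 hx

instance isReduced_sepPart : IsReduced (sepPart A) where
  eq_zero x hx := by
    have h : (x : A) ∈ radPart A := hx.map (sepPart A).val
    exact Subtype.ext (Submodule.disjoint_def.1 (isCompl_sepPart_radPart A).disjoint x x.2 h)

end SeparablePart

theorem theorem9p2 {A : Type*} [CommRing A] [Algebra ℚ A] [FiniteDimensional ℚ A] :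
    Function.Surjective (prFLattice A) ∧
    Function.Surjective (prFEps A) ∧
    ∀ (Λ : FullLattice A) (hΛ : Λ.IsOrder),
      Function.Surjective (latticeGroupMap Λ hΛ) ∧
      Finite (epsGroup Λ hΛ) ∧
      Finite (epsGroup (prFLattice A Λ) hΛ.prFLattice) ∧
      Function.Bijective (epsGroupMap Λ hΛ) := by
  have hnil := isNilpotent_of_prF_eq_zero A
  refine ⟨FullLattice.map_surjective _ _, EpsClass.map_surjective _ _, fun Λ hΛ => ?_⟩
  have hfin : Finite (epsGroup (prFLattice A Λ) hΛ.prFLattice) := EpsClass.finite_epsGroup _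
  have hbij : Function.Bijective (epsGroupMap Λ hΛ) := by
    constructor
    · rw [injective_iff_map_eq_one]
      intro x hx
      exact Subtype.ext (EpsClass.eq_mk_of_map_eq (prF A) (prF_surjective A) hnil hΛ x.2
        (congrArg Subtype.val hx))
    · intro x
      obtain ⟨y, hy, h⟩ :=
        EpsClass.exists_isInvertibleAt_map_eq (prF A) (prF_surjective A) hnil hΛ x.2
      exact ⟨⟨y, hy⟩, Subtype.ext h⟩
  refine ⟨fun L' => ?_, Finite.of_injective _ hbij.1, hfin, hbij⟩
  obtain ⟨L, hL, h⟩ :=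
    FullLattice.exists_isInvertibleAt_map_eq (prF A) (prF_surjective A) hnil hΛ L'.2
  exact ⟨⟨L, hL⟩, Subtype.ext h⟩
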